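/- **Theorem.** Let $X$ be a (finite-dimensional, Hausdorff) complex manifold with complex structure $J$, and let $\Omega\subseteq X$ be a precompact, smoothly bounded, pseudoconvex domain with boundary $M=b\Omega$: that is, $\Omega$ is open and connected, and there are an open set $U\supseteq\overline\Omega$, with $\overline\Omega$ compact, and a $C^\infty$ function $r:U\to\mathbb R$ with $\Omega=\{x\in U: r(x)<0\}$ and $dr_p\neq 0$ for all $p\in M$, such that the Levi form $\partial\overline\partial r$ is positive semidefinite on $T^{1,0}_pM:=\mathbb C T_pM\cap T^{1,0}_pX$ for every $p\in M$. Let $\mathfrak C(\mathcal N)$ be the Levi core of $M$. If $K\subseteq M$ is a local maximum set, then $$K\subseteq S_{\mathfrak C(\mathcal N)}.$$ Here the following notions are used. * The *Levi distribution* of $M$ is the complex distribution $\mathcal N_p=\{Z\in T^{1,0}_pM:\ \partial\overline\partial r(Z,\overline W)=0\ \ \forall\, W\in T^{1,0}_pM\}$, $p\in M$ (it does not depend on the choice of the defining function $r$). * A *complex distribution* $\mathcal D$ on $M$ is a choice of a complex subspace $\mathcal D_p\subseteq\mathbb C T_pM$ for every $p\in M$. Its *support* is $S_{\mathcal D}=\{p\in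 M:\mathcal D_p\ne\{0\}\}$. For $A\subseteq M$, $T_pA$ is the space of all real tangent vectors $v$ at $p$ such that $df_p(v)=0$ for every smooth real function $f$ vanishing on $A$. The *derived distribution* is $\mathcal D'_p=\mathcal D_p\cap\mathbb C T_pS_{\mathcal D}$. By transfinite recursion, $\mathcal D^{(0)}=\mathcal D$, $\mathcal D^{(\alpha+1)}=(\mathcal D^{(\alpha)})'$, and $\mathcal D^{(\alpha)}=\bigcap_{\beta<\alpha}\mathcal D^{(\beta)}$ for limit ordinals $\alpha$. The *core* of $\mathcal D$ is $\mathfrak C(\mathcal D)=\mathcal D^{(\omega_1)}$, where $\omega_1$ is the first uncountable ordinal; the *Levi core* of $M$ is $\mathfrak C(\mathcal N)$. * A locally closed set $K\subseteq X$ is a *local maximum set* (Slodkowski) if every $x\in K$ has arbitrarily small relatively compact open neighbourhoods $U$ such that $\overline U$ is contained in a coordinate neighbourhood of $X$, $K\cap\overline U$ is closed, and for every function $\psi$ plurisubharmonic in a neighbourhood of $\overline U$ $$\max_{\overline U\cap K}\psi=\max_{bU\cap K}\psi,\qquad bU=\overline U\setminus U .$$ -/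

import Mathlib

open Set Topology
open scoped Manifold ContDiff TensorProduct

namespace LeviCore

noncomputable section

/- Throughout, `X` is a complex manifold modelled on the finite-dimensional complex vector space `E`.
The underlying real smooth manifold is `X` with the real model `𝓘(ℝ, E)`; the real tangent space
`TangentSpace 𝓘(ℝ, E) p` is `E`, read in the preferred holomorphic chart at `p`. -/

/-! ### Complexified tangent vectors, complex distributions, the core -/

/-- The complexified tangent space `ℂ T_p X = ℂ ⊗_ℝ T_p X`. -/
abbrev ComplexTangent (E : Type*) [NormedAddCommGroup E] [NormedSpace ℂ E]
    {X : Type*} [TopologicalSpace X] [ChartedSpace E X] (p : X) : Type _ :=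
  ℂ ⊗[ℝ] TangentSpace 𝓘(ℝ, E) p

/-- Conjugation `a ⊗ v ↦ conj a ⊗ v` on the complexified tangent space. -/
def conjC (E : Type*) [NormedAddCommGroup E] [NormedSpace ℂ E]
    {X : Type*} [TopologicalSpace X] [ChartedSpace E X] (p : X) :
    ComplexTangent E p →ₗ[ℝ] ComplexTangent E p :=
  LinearMap.rTensor (TangentSpace 𝓘(ℝ, E) p) Complex.conjAe.toLinearMap

/-- The complex structure `J` on the real tangent space: multiplication by `i` in a holomorphic
chart. -/
def complexStructure (E : Type*) [NormedAddCommGroup E] [NormedSpace ℂ E]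
    {X : Type*} [TopologicalSpace X] [ChartedSpace E X] (p : X) :
    TangentSpace 𝓘(ℝ, E) p →ₗ[ℝ] TangentSpace 𝓘(ℝ, E) p :=
  ((Complex.I • (LinearMap.id : E →ₗ[ℂ] E)).restrictScalars ℝ : E →ₗ[ℝ] E)

/-- The holomorphic tangent space `T^{1,0}_p X`: the `i`-eigenspace of the complexified `J`. -/
def holTangent (E : Type*) [NormedAddCommGroup E] [NormedSpace ℂ E]
    {X : Type*} [TopologicalSpace X] [ChartedSpace E X] (p : X) :
    Submodule ℂ (ComplexTangent E p) :=
  Module.End.eigenspace ((complexStructure E p).baseChange ℂ) Complex.I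

/-- The (real) tangent space `T_p A` to an arbitrary subset `A`: the tangent vectors that annihilate
every smooth function vanishing on `A`. -/
def tangentTo (E : Type*) [NormedAddCommGroup E] [NormedSpace ℂ E]
    {X : Type*} [TopologicalSpace X] [ChartedSpace E X] (A : Set X) (p : X) :
    Submodule ℝ (TangentSpace 𝓘(ℝ, E) p) where
  carrier := {v | ∀ f : X → ℝ, ContMDiff 𝓘(ℝ, E) 𝓘(ℝ, ℝ) ∞ f → (∀ a ∈ A, f a = 0) →
    mfderiv 𝓘(ℝ, E) 𝓘(ℝ, ℝ) f p v = 0}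
  add_mem' := by
    intro v w hv hw f hf hA
    rw [map_add, hv f hf hA, hw f hf hA, add_zero]
  zero_mem' := by
    intro f _ _
    exact map_zero _
  smul_mem' := by
    intro c v hv f hf hA
    rw [map_smul, hv f hf hA, smul_zero]

/-- A complex distribution on a subset `M` of `X` (below, a smooth real hypersurface): a complex
linear subspace of `ℂ T_p X` at every `p ∈ M`, with no regularity in `p`. The distributions
considered below have fibres contained in `ℂ T_p M`. -/
abbrev ComplexDistribution (E : Type*) [NormedAddCommGroup E] [NormedSpace ℂ E]
    {X : Type*} [TopologicalSpace X] [ChartedSpace E X] (M : Set X) : Type _ :=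
  ∀ p : M, Submodule ℂ (ComplexTangent E (p : X))

section Distribution

variable {E : Type*} [NormedAddCommGroup E] [NormedSpace ℂ E]
  {X : Type*} [TopologicalSpace X] [ChartedSpace E X] {M : Set X}

/-- The support `S_D`: the points of `M` where the fibre of `D` is not zero. -/
def ComplexDistribution.support (D : ComplexDistribution E M) : Set X :=
  {x | ∃ h : x ∈ M, D ⟨x, h⟩ ≠ ⊥}

/-- The derived distribution `D' = D ∩ ℂ T S_D`. -/
def ComplexDistribution.derived (D : ComplexDistribution E M) : ComplexDistribution E M :=
  fun p => D p ⊓ (tangentTo E (ComplexDistribution.support D) (p : X)).baseChange ℂ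

/-- The iterated derived distributions `D^(α)`, for an ordinal `α`: `D^(0) = D`,
`D^(α+1) = (D^(α))'`, and `D^(α) = ⋂_{β<α} D^(β)` for `α` a limit ordinal. -/
def ComplexDistribution.iterDerived (D : ComplexDistribution E M) (α : Ordinal.{0}) :
    ComplexDistribution E M :=
  Ordinal.limitRecOn α D (fun _ D' => ComplexDistribution.derived D')
    (fun α _ F p => ⨅ β : Set.Iio α, F β.1 β.2 p)

/-- The core `D^(ω₁)` of a distribution. -/
def ComplexDistribution.core (D : ComplexDistribution E M) : ComplexDistribution E M :=
  ComplexDistribution.iterDerived D (Ordinal.omega 1)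

end Distribution

/-! ### Smoothly bounded pseudoconvex domains and the Levi core of their boundary -/

/-- `r`, considered on the open set `U`, is a (smooth) defining function of the relatively compact
set `Ω`: `Ω ⋐ U`, `Ω = {x ∈ U | r x < 0}`, and `dr ≠ 0` along the boundary of `Ω`. -/
structure IsDefiningFunction (E : Type*) [NormedAddCommGroup E] [NormedSpace ℂ E]
    {X : Type*} [TopologicalSpace X] [ChartedSpace E X] (Ω U : Set X) (r : X → ℝ) : Prop where
  isOpen : IsOpen U
  isCompact_closure : IsCompact (closure Ω)
  closure_subset : closure Ω ⊆ U
  contMDiffOn : ContMDiffOn 𝓘(ℝ, E) 𝓘(ℝ, ℝ) ∞ r U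
  eq_setOf : Ω = {x | x ∈ U ∧ r x < 0}
  mfderiv_ne_zero : ∀ p ∈ frontier Ω, mfderiv 𝓘(ℝ, E) 𝓘(ℝ, ℝ) r p ≠ 0

section Levi

variable (E : Type*) [NormedAddCommGroup E] [NormedSpace ℂ E]
  {X : Type*} [TopologicalSpace X] [ChartedSpace E X]

/-- The real Hessian of `r` at `p`, computed in the preferred holomorphic chart at `p`. -/
def realHessian (r : X → ℝ) (p : X) : LinearMap.BilinForm ℝ (TangentSpace 𝓘(ℝ, E) p) :=
  (fderiv ℝ (fderiv ℝ (r ∘ (chartAt E p).symm)) (chartAt E p p)).toBilinForm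

/-- `∂∂̄r(Z, W̄)` for `Z, W ∈ T^{1,0}_p X`: the complex bilinear extension of the real Hessian,
evaluated at `Z` and `W̄`. In the holomorphic coordinates of the chart,
`Z = ∑ a_j ∂_{z_j}` and `W = ∑ b_k ∂_{z_k}` give `∑ (∂²r / ∂z_j ∂z̄_k) a_j b̄_k`. -/
def leviForm (r : X → ℝ) (p : X) (Z W : ComplexTangent E p) : ℂ :=
  (realHessian E r p).baseChange ℂ Z (conjC E p W)

/-- `T^{1,0}_p M = ℂ T_p M ∩ T^{1,0}_p X` for the hypersurface `M = {r = 0}`, whose tangent space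
is `T_p M = ker dr_p`. -/
def crTangent (r : X → ℝ) (p : X) : Submodule ℂ (ComplexTangent E p) :=
  (LinearMap.ker (mfderiv 𝓘(ℝ, E) 𝓘(ℝ, ℝ) r p).toLinearMap).baseChange ℂ ⊓ holTangent E p

/-- `∂∂̄r` is positive semidefinite on `T^{1,0} bΩ`; a smoothly bounded domain is pseudoconvex if
this holds for one, equivalently for every, defining function `r`. -/
def IsLeviPseudoconvex (Ω : Set X) (r : X → ℝ) : Prop :=
  ∀ p ∈ frontier Ω, ∀ Z ∈ crTangent E r p, 0 ≤ (leviForm E r p Z Z).re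

/-- The Levi distribution `N` of `M = bΩ`: the null distribution of the Levi form
`λ_θ = (1 / 2i) dθ = ∂∂̄r` on `T^{1,0} M`, where `θ` is the pseudo-Hermitian structure
`d^c r = i (∂ - ∂̄) r` of `M`. Another defining function multiplies the Levi form by a nowhere
vanishing function on `M`, so that `N` does not depend on `r`. -/
def leviDistribution (Ω : Set X) (r : X → ℝ) : ComplexDistribution E (frontier Ω) := fun p =>
  { carrier := {Z | Z ∈ crTangent E r (p : X) ∧
      ∀ W ∈ crTangent E r (p : X), leviForm E r (p : X) Z W = 0}
    add_mem' := by
      rintro Z Z' ⟨hZ, hZ0⟩ ⟨hZ', hZ0'⟩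
      refine ⟨add_mem hZ hZ', fun W hW => ?_⟩
      have h1 := hZ0 W hW
      have h2 := hZ0' W hW
      unfold leviForm at h1 h2 ⊢
      rw [map_add, LinearMap.add_apply, h1, h2, add_zero]
    zero_mem' := by
      refine ⟨zero_mem _, fun W _ => ?_⟩
      unfold leviForm
      rw [map_zero, LinearMap.zero_apply]
    smul_mem' := by
      rintro c Z ⟨hZ, hZ0⟩
      refine ⟨Submodule.smul_mem _ c hZ, fun W hW => ?_⟩
      have h1 := hZ0 W hW
      unfold leviForm at h1 ⊢
      rw [map_smul, LinearMap.smul_apply, h1, smul_zero] }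

/-- The Levi core of `bΩ`: the core of its Levi distribution. -/
def leviCore (Ω : Set X) (r : X → ℝ) : ComplexDistribution E (frontier Ω) :=
  ComplexDistribution.core (leviDistribution E Ω r)

end Levi

/-! ### Plurisubharmonic functions and local maximum sets -/

/-- Plurisubharmonic functions `u : G → [-∞, ∞)` on an open subset `G` of a complex vector space:
upper semicontinuous functions with the sub-mean value property on the circle
`{a + τ b : |τ| = 1}` whenever the closed disc `{a + τ b : |τ| ≤ 1}` lies in `G`. The mean of the
upper semicontinuous function `u` over the circle is the infimum of the means of the continuous
functions `g ≥ u` on the circle. -/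
def IsPSHOn {E : Type*} [NormedAddCommGroup E] [NormedSpace ℂ E] (u : E → EReal) (G : Set E) :
    Prop :=
  UpperSemicontinuousOn u G ∧ (∀ z ∈ G, u z ≠ ⊤) ∧
    ∀ a b : E, (∀ τ ∈ Metric.closedBall (0 : ℂ) 1, a + τ • b ∈ G) →
      ∀ g : ℂ → ℝ, ContinuousOn g (Metric.sphere 0 1) →
        (∀ τ ∈ Metric.sphere (0 : ℂ) 1, u (a + τ • b) ≤ (g τ : EReal)) →
        u a ≤ ((Real.circleAverage g 0 1 : ℝ) : EReal)

/-- Plurisubharmonic functions on an open subset `W` of a complex manifold: plurisubharmonic in some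
(equivalently, every) holomorphic chart near every point of `W`. -/
def IsPSHOnManifold (E : Type*) [NormedAddCommGroup E] [NormedSpace ℂ E]
    {X : Type*} [TopologicalSpace X] [ChartedSpace E X] (ψ : X → EReal) (W : Set X) : Prop :=
  ∀ p ∈ W, ∃ e ∈ IsManifold.maximalAtlas 𝓘(ℂ, E) ω X, p ∈ e.source ∧
    ∃ V ⊆ e.source ∩ W, IsOpen V ∧ p ∈ V ∧ IsPSHOn (ψ ∘ e.symm) (e '' V)

/-- Local maximum sets (in the sense of Slodkowski): `K` is locally closed, and every `x ∈ K` has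
arbitrarily small relatively compact open neighbourhoods `U` such that the closure of `U` lies in a
holomorphic coordinate neighbourhood, `K ∩ closure U` is closed, and
`max_{closure U ∩ K} ψ = max_{bU ∩ K} ψ`, `bU = closure U \ U`, for every `ψ` plurisubharmonic in a
neighbourhood of `closure U`. (As `bU ∩ K` is compact, the equality says that the maximum of `ψ` over
`closure U ∩ K` is attained at a point of `bU ∩ K`.) -/
def IsLocalMaximumSet (E : Type*) [NormedAddCommGroup E] [NormedSpace ℂ E]
    {X : Type*} [TopologicalSpace X] [ChartedSpace E X] (K : Set X) : Prop :=
  IsLocallyClosed K ∧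
  ∀ x ∈ K, ∀ N ∈ 𝓝 x, ∃ U ⊆ N, IsOpen U ∧ x ∈ U ∧ IsCompact (closure U) ∧
    (∃ e ∈ IsManifold.maximalAtlas 𝓘(ℂ, E) ω X, closure U ⊆ e.source) ∧
    IsClosed (K ∩ closure U) ∧
    ∀ (W : Set X) (ψ : X → EReal), IsOpen W → closure U ⊆ W → IsPSHOnManifold E ψ W →
      ∃ q ∈ (closure U \ U) ∩ K, ∀ y ∈ closure U ∩ K, ψ y ≤ ψ q

end

end LeviCore

/-!
Let `p ∈ K`. If `K` is contained in the support `S_D` of a distribution `D`, then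
`T_p K ⊆ T_p S_D`. Hence, by transfinite induction, the subspace
`N_p ∩ ℂ T_p K` is contained in the fibre at `p` of every iterated derived distribution of the Levi
distribution `N` as soon as it is nonzero at every point of `K`
(`ComplexDistribution.inf_tangentTo_le_iterDerived`).

So it is enough to show `N_p ∩ ℂ T_p K ≠ 0` (`levi_inf_tangentTo_ne_bot`). Suppose that it is zero,
and let `H` be the Hessian of the defining function `r` in the chart at `p`. For a real tangent vector
`v ≠ 0`, either `H(v, v) + H(Jv, Jv) > 0`, or the differential `ℓ` at `p` of some smooth function
vanishing on `K` satisfies `ℓ(v) ≠ 0` or `ℓ(Jv) ≠ 0`. Otherwise, `Z = v - i J v` would be tangent to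
`K` and to the boundary, with `∂∂̄r(Z, Z̄) ≤ 0`; by pseudoconvexity and the Cauchy–Schwarz inequality
it would be a nonzero element of `N_p ∩ ℂ T_p K`. By compactness of the sphere, finitely many `ℓ_k`
make the Hermitian part of `H + ∑ ℓ_k²` positive definite (`exists_finset_forall_pos`). For a small
`ε > 0` the quadratic polynomial

  `u(y) = dr(y) + H(y, y) / 2 + ∑ ℓ_k(y)² / 2 - ε |y|²`

in the coordinates centred at `p` is then plurisubharmonic. On `K` the first two terms add up to
`o(|y|²)` by Taylor's formula, as `r = 0` there, and `ℓ_k(y) = o(|y|)`. So `u < 0 = u(0)` on `K`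
near `p`, away from `p` (`exists_four_point_barrier`), which no local maximum set allows
(`IsLocalMaximumSet.not_eventually_neg`).

As only quadratic polynomials have to be plurisubharmonic, the sub-mean value property comes from an
inequality between five values: `4 u(a) ≤ u(a + b) + u(a - b) + u(a + i b) + u(a - i b)`, averaged
over the rotations of `b`.
-/

namespace LeviCore

/-! ### The sub-mean value property from a four-point inequality -/

section Quadratic
variable {E : Type*} [NormedAddCommGroup E] [NormedSpace ℂ E]

lemma circleAverage_comp_mul_of_norm_eq_one (f : ℂ → ℝ) {c : ℂ} (hc : ‖c‖ = 1) :
    Real.circleAverage (fun τ => f (c * τ)) 0 1 = Real.circleAverage f 0 1 := by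
  have h : Complex.exp (c.arg * Complex.I) = c := by
    simpa [hc] using Complex.norm_mul_exp_arg_mul_I c
  rw [Real.circleAverage_eq_integral_add (f := f) c.arg, Real.circleAverage_def]
  simp [circleMap_zero, add_mul, Complex.exp_add, h, mul_comm c]

/-- The average of the right-hand side of the four-point inequality at `τ b`, over the circle
`|τ| = 1`, is four times the circle average of `u`, since circle averages are invariant under
rotations. -/
lemma le_circleAverage_of_four_point {u : E → ℝ} (hc : Continuous u)
    (h4 : ∀ a b, 4 * u a ≤ u (a + b) + u (a - b) + u (a + Complex.I • b) + u (a - Complex.I • b))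
    (a b : E) : u a ≤ Real.circleAverage (fun τ => u (a + τ • b)) 0 1 := by
  set F : ℂ → ℝ := fun τ => u (a + τ • b) with hF
  have hcont : Continuous F := by fun_prop
  set P : ℂ → ℂ → ℝ := fun c τ => F (c * τ) with hP
  have hi : ∀ c : ℂ, CircleIntegrable (P c) 0 1 := fun c =>
    (show Continuous (P c) by fun_prop).continuousOn.circleIntegrable'
  have hrot : ∀ c : ℂ, ‖c‖ = 1 → Real.circleAverage (P c) 0 1 = Real.circleAverage F 0 1 :=
    fun c h => circleAverage_comp_mul_of_norm_eq_one F h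
  have hi4 : CircleIntegrable (P 1 + P (-1) + P Complex.I + P (-Complex.I)) 0 1 :=
    (((hi _).add (hi _)).add (hi _)).add (hi _)
  have hsum : Real.circleAverage (P 1 + P (-1) + P Complex.I + P (-Complex.I)) 0 1
      = 4 * Real.circleAverage F 0 1 := by
    rw [Real.circleAverage_add (((hi _).add (hi _)).add (hi _)) (hi _),
      Real.circleAverage_add ((hi _).add (hi _)) (hi _),
      Real.circleAverage_add (hi _) (hi _), hrot _ (by simp), hrot _ (by simp),
      hrot _ (by simp), hrot _ (by simp)]
    ring
  have hle : Real.circleAverage (fun _ : ℂ => 4 * u a) 0 1 ≤ 4 * Real.circleAverage F 0 1 := by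
    rw [← hsum]
    refine Real.circleAverage_mono (circleIntegrable_const _ _ _) hi4 fun τ _ => ?_
    have := h4 a (τ • b)
    simpa [hP, hF, mul_smul, sub_eq_add_neg] using this
  rw [Real.circleAverage_const] at hle
  linarith

lemma isPSHOn_of_four_point {u : E → ℝ} (hc : Continuous u)
    (h4 : ∀ a b, 4 * u a ≤ u (a + b) + u (a - b) + u (a + Complex.I • b) + u (a - Complex.I • b))
    {v : E → EReal} {G : Set E} (hv : ∀ z ∈ G, v z = (u z : EReal)) : IsPSHOn v G := by
  refine ⟨?_, fun z hz => by simp [hv z hz], fun a b hab g hg hle => ?_⟩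
  · have h : UpperSemicontinuousOn (fun z => (u z : EReal)) G :=
      (continuous_coe_real_ereal.comp hc).upperSemicontinuous.upperSemicontinuousOn G
    intro z hz y hy
    rw [hv z hz] at hy
    filter_upwards [h z hz y hy, self_mem_nhdsWithin] with w hw hwG
    rwa [hv w hwG]
  · rw [hv a (by simpa using hab 0 (by simp)), EReal.coe_le_coe_iff]
    have hcu : Continuous fun τ : ℂ => u (a + τ • b) := by fun_prop
    refine (le_circleAverage_of_four_point hc h4 a b).trans
      (Real.circleAverage_mono hcu.continuousOn.circleIntegrable'
        (ContinuousOn.circleIntegrable' (by simpa using hg)) fun τ hτ => ?_)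
    have hτ' : τ ∈ Metric.sphere (0 : ℂ) 1 := by simpa using hτ
    have := hle τ hτ'
    rwa [hv _ (hab τ (Metric.sphere_subset_closedBall hτ')), EReal.coe_le_coe_iff] at this

end Quadratic

/-! ### Taylor's formula of order two -/

section Taylor
variable {E : Type*} [NormedAddCommGroup E] [NormedSpace ℝ E]

lemma taylor_two_isLittleO {f : E → ℝ} {x : E} (hf : ContDiffAt ℝ 2 f x) :
    (fun y => f (x + y) - f x - fderiv ℝ f x y - (1 / 2) * fderiv ℝ (fderiv ℝ f) x y y)
      =o[𝓝 0] fun y => ‖y‖ ^ 2 := by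
  have hsymm : IsSymmSndFDerivAt ℝ f x := hf.isSymmSndFDerivAt (by simp)
  have hd : DifferentiableAt ℝ (fderiv ℝ f) x :=
    (hf.fderiv_right (m := 1) (by norm_num)).differentiableAt (by norm_num)
  have hev : ∀ᶠ z in 𝓝 x, DifferentiableAt ℝ f z :=
    (hf.eventually (by simp)).mono fun z hz => hz.differentiableAt (by norm_num)
  set g : E → ℝ := fun y =>
    f (x + y) - f x - fderiv ℝ f x y - (1 / 2) * fderiv ℝ (fderiv ℝ f) x y y with hg
  have hev0 : ∀ᶠ y in 𝓝 (0 : E), DifferentiableAt ℝ f (x + y) := by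
    have : Filter.Tendsto (fun y : E => x + y) (𝓝 0) (𝓝 x) := by
      simpa using (continuous_const_add x).tendsto (0 : E)
    exact this.eventually hev
  have hderiv : ∀ y, DifferentiableAt ℝ f (x + y) → HasFDerivAt g
      (fderiv ℝ f (x + y) - fderiv ℝ f x - fderiv ℝ (fderiv ℝ f) x y) y := by
    intro y hy
    have h1 : HasFDerivAt (fun y => f (x + y)) (fderiv ℝ f (x + y)) y :=
      (hasFDerivAt_comp_add_left x).mpr hy.hasFDerivAt
    have h2 : HasFDerivAt (fun y => fderiv ℝ f x y) (fderiv ℝ f x) y :=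
      (fderiv ℝ f x).hasFDerivAt
    have h3 := ((fderiv ℝ (fderiv ℝ f) x).hasFDerivAt (x := y)).clm_apply (hasFDerivAt_id y)
    refine (((h1.sub_const (f x)).sub h2).sub (h3.const_mul (1 / 2 : ℝ))).congr_fderiv ?_
    ext w
    have := hsymm.eq w y
    simp [this]
    ring
  rw [Asymptotics.isLittleO_iff]
  intro c hc
  have hlo := (hasFDerivAt_iff_isLittleO_nhds_zero.mp hd.hasFDerivAt)
  obtain ⟨δ, hδ, hball⟩ := Metric.eventually_nhds_iff_ball.mp
    ((Asymptotics.isLittleO_iff.mp hlo hc).and hev0)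
  refine Metric.eventually_nhds_iff_ball.mpr ⟨δ, hδ, fun y hy => ?_⟩
  have hyδ : ‖y‖ < δ := by simpa using hy
  have hsub : ∀ z ∈ Metric.closedBall (0 : E) ‖y‖, z ∈ Metric.ball (0 : E) δ := fun z hz => by
    simp only [mem_closedBall_zero_iff, mem_ball_zero_iff] at hz ⊢
    exact hz.trans_lt hyδ
  have hmv := (convex_closedBall (0 : E) ‖y‖).norm_image_sub_le_of_norm_hasFDerivWithin_le
    (f := g) (C := c * ‖y‖) (x := 0) (y := y)
    (fun z hz => (hderiv z (hball z (hsub z hz)).2).hasFDerivWithinAt)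
    (fun z hz => (hball z (hsub z hz)).1.trans (by
      have : ‖z‖ ≤ ‖y‖ := by simpa using hz
      gcongr)) (by simp) (by simp)
  have hg0 : g 0 = 0 := by simp [hg]
  rw [hg0, sub_zero, sub_zero] at hmv
  refine hmv.trans (le_of_eq ?_)
  rw [norm_pow, norm_norm]; ring

end Taylor

/-! ### Quadratic plurisubharmonic barriers -/

section Barrier
variable {E : Type*} [NormedAddCommGroup E] [NormedSpace ℂ E]

/-- A family `F` of real linear forms that is closed under scaling and detects every `v ≠ 0` at which
`L` fails to be positive contains finitely many forms whose squares make `L` positive on the whole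
unit sphere. -/
lemma exists_finset_forall_pos [FiniteDimensional ℂ E] {F : Set (E →L[ℝ] ℝ)}
    (hF : ∀ ℓ ∈ F, ∀ s : ℝ, s • ℓ ∈ F) {L : E → ℝ} (hL : Continuous L)
    (h : ∀ v ≠ 0, 0 < L v ∨ ∃ ℓ ∈ F, ℓ v ≠ 0 ∨ ℓ (Complex.I • v) ≠ 0) (h0 : 0 ∈ F) :
    ∃ t : Finset F, ∀ v ∈ Metric.sphere (0 : E) 1,
      0 < L v + ∑ ℓ ∈ t, ((ℓ : E →L[ℝ] ℝ) v ^ 2 + (ℓ : E →L[ℝ] ℝ) (Complex.I • v) ^ 2) := by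
  have : ProperSpace E := FiniteDimensional.proper ℂ E
  obtain ⟨t, ht⟩ := (isCompact_sphere (0 : E) 1).elim_finite_subcover
    (fun ℓ : F => {v | 0 < L v + ((ℓ : E →L[ℝ] ℝ) v ^ 2 + (ℓ : E →L[ℝ] ℝ) (Complex.I • v) ^ 2)})
    (fun ℓ => isOpen_lt continuous_const (by fun_prop)) (fun v hv => by
      have hv0 : v ≠ 0 := by
        rintro rfl
        simp at hv
      rw [mem_iUnion]
      rcases h v hv0 with hpos | ⟨ℓ, hℓ, hne⟩
      · exact ⟨⟨0, h0⟩, by simpa using hpos⟩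
      · set c := ℓ v ^ 2 + ℓ (Complex.I • v) ^ 2 with hc
        have hcpos : 0 < c := by
          rcases hne with h1 | h1 <;> positivity
        -- a large multiple of `ℓ` outweighs a possibly negative value of `L`
        set s := (|L v| + 1) / c + 1 with hs
        have hs1 : 1 ≤ s := by
          rw [hs]
          have : 0 ≤ (|L v| + 1) / c := by positivity
          linarith
        have hsc : s * c = |L v| + 1 + c := by rw [hs]; field_simp
        have hle : s * c ≤ s ^ 2 * c := by gcongr; nlinarith
        refine ⟨⟨s • ℓ, hF ℓ hℓ s⟩, ?_⟩
        have hexp : ((s • ℓ) v ^ 2 + (s • ℓ) (Complex.I • v) ^ 2) = s ^ 2 * c := by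
          simp only [smul_apply, smul_eq_mul, hc]
          ring
        simp only [mem_ofPred_eq]
        rw [hexp]
        linarith [neg_abs_le (L v)])
  refine ⟨t, fun v hv => ?_⟩
  obtain ⟨ℓ, hℓ, hpos⟩ := mem_iUnion₂.mp (ht hv)
  have hsingle := Finset.single_le_sum
    (f := fun ℓ : F => (ℓ : E →L[ℝ] ℝ) v ^ 2 + (ℓ : E →L[ℝ] ℝ) (Complex.I • v) ^ 2)
    (fun ℓ _ => by positivity) hℓ
  simp only [mem_ofPred_eq] at hpos
  linarith

/-- If `ρ` vanishes on `A` and the positivity of the Hermitian part of its Hessian at `x` fails only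
in directions detected by linear forms that vanish to first order on `A`, then there is a
quadratic polynomial with the four-point inequality, hence plurisubharmonic, which has a strict local
maximum over `A ∪ {x}` at `x`. -/
lemma exists_four_point_barrier [FiniteDimensional ℂ E] {A : Set E} {x : E} {ρ : E → ℝ}
    (hρ : ContDiffAt ℝ 2 ρ x) (hρx : ρ x = 0) (hρA : ∀ y ∈ A, ρ y = 0)
    (h : ∀ v ≠ 0, 0 < fderiv ℝ (fderiv ℝ ρ) x v v
          + fderiv ℝ (fderiv ℝ ρ) x (Complex.I • v) (Complex.I • v) ∨
        ∃ ℓ : E →L[ℝ] ℝ, ((fun y => ℓ (y - x)) =o[𝓝[A] x] fun y => y - x) ∧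
          (ℓ v ≠ 0 ∨ ℓ (Complex.I • v) ≠ 0)) :
    ∃ u : E → ℝ, Continuous u ∧
      (∀ a b, 4 * u a ≤
        u (a + b) + u (a - b) + u (a + Complex.I • b) + u (a - Complex.I • b)) ∧
      u x = 0 ∧ ∀ᶠ y in 𝓝[A] x, y ≠ x → u y < 0 := by
  have : ProperSpace E := FiniteDimensional.proper ℂ E
  set H := fderiv ℝ (fderiv ℝ ρ) x with hH
  set d := fderiv ℝ ρ x with hd
  set F : Set (E →L[ℝ] ℝ) := {ℓ | (fun y => ℓ (y - x)) =o[𝓝[A] x] fun y => y - x} with hF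
  have hFsmul : ∀ ℓ ∈ F, ∀ s : ℝ, s • ℓ ∈ F := fun ℓ hℓ s =>
    Asymptotics.IsLittleO.const_smul_left (f' := fun y => ℓ (y - x)) hℓ s
  have hF0 : (0 : E →L[ℝ] ℝ) ∈ F := by
    simp [hF]
  obtain ⟨t, ht⟩ := exists_finset_forall_pos hFsmul
    (L := fun v => H v v + H (Complex.I • v) (Complex.I • v)) (by fun_prop) h hF0
  set S : E → ℝ := fun v => H v v + H (Complex.I • v) (Complex.I • v)
    + ∑ ℓ ∈ t, ((ℓ : E →L[ℝ] ℝ) v ^ 2 + (ℓ : E →L[ℝ] ℝ) (Complex.I • v) ^ 2) with hS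
  obtain ⟨m, hm, hmS⟩ := (isCompact_sphere (0 : E) 1).exists_forall_le'
    (f := S) (by fun_prop) ht
  have hShom : ∀ (c : ℝ) v, S (c • v) = c ^ 2 * S v := by
    intro c v
    simp only [hS, smul_comm Complex.I c v, map_smul, smul_apply, smul_eq_mul,
      mul_add, Finset.mul_sum]
    congr 1
    · ring
    · exact Finset.sum_congr rfl fun ℓ _ => by ring
  have hSm : ∀ v, m * ‖v‖ ^ 2 ≤ S v := by
    intro v
    rcases eq_or_ne v 0 with rfl | hv
    · have := hShom 0 0
      simp only [smul_zero] at this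
      rw [this]
      simp
    · have hn : 0 < ‖v‖ := norm_pos_iff.mpr hv
      have h1 := hmS (‖v‖⁻¹ • v) (by simp [norm_smul, hn.ne'])
      have h2 := hShom ‖v‖ (‖v‖⁻¹ • v)
      rw [smul_smul, mul_inv_cancel₀ hn.ne', one_smul] at h2
      rw [h2, mul_comm]
      gcongr
  -- a Hilbert norm on `E`, since the given norm need not satisfy the parallelogram law
  let T : E ≃L[ℂ] EuclideanSpace ℂ (Fin (Module.finrank ℂ E)) :=
    ContinuousLinearEquiv.ofFinrankEq (by simp)
  set M : ℝ := ‖(T : E →L[ℂ] EuclideanSpace ℂ (Fin (Module.finrank ℂ E)))‖ ^ 2 + 1 with hM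
  set N : ℝ := ‖(T.symm : EuclideanSpace ℂ (Fin (Module.finrank ℂ E)) →L[ℂ] E)‖ ^ 2 + 1 with hN
  have hMpos : 0 < M := by positivity
  have hNpos : 0 < N := by positivity
  have hTM : ∀ v, ‖T v‖ ^ 2 ≤ M * ‖v‖ ^ 2 := by
    intro v
    have := (T : E →L[ℂ] EuclideanSpace ℂ (Fin (Module.finrank ℂ E))).le_opNorm v
    have h2 : ‖T v‖ ^ 2 ≤ (‖(T : E →L[ℂ] EuclideanSpace ℂ (Fin (Module.finrank ℂ E)))‖ * ‖v‖) ^ 2 :=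
      pow_le_pow_left₀ (norm_nonneg _) this 2
    rw [mul_pow] at h2
    rw [hM, add_mul]
    nlinarith [sq_nonneg ‖v‖]
  have hTN : ∀ v, ‖v‖ ^ 2 ≤ N * ‖T v‖ ^ 2 := by
    intro v
    have := (T.symm : EuclideanSpace ℂ (Fin (Module.finrank ℂ E)) →L[ℂ] E).le_opNorm (T v)
    simp only [ContinuousLinearEquiv.coe_coe, ContinuousLinearEquiv.symm_apply_apply] at this
    have h2 := pow_le_pow_left₀ (norm_nonneg _) this 2
    rw [mul_pow] at h2
    rw [hN, add_mul]
    nlinarith [sq_nonneg ‖T v‖]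
  set ε : ℝ := m / (4 * M) with hε
  have hεpos : 0 < ε := by positivity
  have hεm : ∀ v, 4 * (ε * ‖T v‖ ^ 2) ≤ m * ‖v‖ ^ 2 := by
    intro v
    have h1 : 4 * (ε * ‖T v‖ ^ 2) ≤ 4 * (ε * (M * ‖v‖ ^ 2)) := by gcongr; exact hTM v
    refine h1.trans (le_of_eq ?_)
    rw [hε]
    field_simp
  have hpar : ∀ a b, ‖T (a + b)‖ ^ 2 + ‖T (a - b)‖ ^ 2 = 2 * ‖T a‖ ^ 2 + 2 * ‖T b‖ ^ 2 := by
    intro a b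
    have := parallelogram_law_with_norm ℂ (T a) (T b)
    rw [map_add, map_sub]
    linarith
  set q : E → ℝ := fun y => d y + (1 / 2) * H y y
    + (1 / 2) * (∑ ℓ ∈ t, (ℓ : E →L[ℝ] ℝ) y ^ 2) - ε * ‖T y‖ ^ 2 with hq
  -- applied to `b` and to `i b`, this adds up to the four-point inequality, as `4 ε ‖T b‖² ≤ S b`
  have hqpair : ∀ a b, q (a + b) + q (a - b) = 2 * q a + (H b b
      + ∑ ℓ ∈ t, (ℓ : E →L[ℝ] ℝ) b ^ 2 - 2 * ε * ‖T b‖ ^ 2) := by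
    intro a b
    have hsum : ∑ ℓ ∈ t, (ℓ : E →L[ℝ] ℝ) (a + b) ^ 2 + ∑ ℓ ∈ t, (ℓ : E →L[ℝ] ℝ) (a - b) ^ 2
        = 2 * ∑ ℓ ∈ t, (ℓ : E →L[ℝ] ℝ) a ^ 2 + 2 * ∑ ℓ ∈ t, (ℓ : E →L[ℝ] ℝ) b ^ 2 := by
      rw [← Finset.sum_add_distrib, Finset.mul_sum, Finset.mul_sum, ← Finset.sum_add_distrib]
      refine Finset.sum_congr rfl fun ℓ _ => ?_
      rw [map_add, map_sub]
      ring
    have hHab : H (a + b) (a + b) + H (a - b) (a - b) = 2 * H a a + 2 * H b b := by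
      simp only [map_add, map_sub, add_apply, sub_apply]
      ring
    have hdab : d (a + b) + d (a - b) = 2 * d a := by
      rw [map_add, map_sub]
      ring
    simp only [hq]
    linear_combination hdab + (1 / 2) * hHab + (1 / 2) * hsum - ε * hpar a b
  refine ⟨fun y => q (y - x), by fun_prop, fun a b => ?_, by simp [hq], ?_⟩
  · have h1 := hqpair (a - x) b
    have h2 := hqpair (a - x) (Complex.I • b)
    have hI : ‖T (Complex.I • b)‖ = ‖T b‖ := by rw [map_smul, norm_smul]; simp
    have h3 : H b b + H (Complex.I • b) (Complex.I • b) + (∑ ℓ ∈ t, (ℓ : E →L[ℝ] ℝ) b ^ 2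
        + ∑ ℓ ∈ t, (ℓ : E →L[ℝ] ℝ) (Complex.I • b) ^ 2) = S b := by
      rw [hS, ← Finset.sum_add_distrib]
    rw [hI] at h2
    have e1 : a + b - x = a - x + b := by abel
    have e2 : a - b - x = a - x - b := by abel
    have e3 : a + Complex.I • b - x = a - x + Complex.I • b := by abel
    have e4 : a - Complex.I • b - x = a - x - Complex.I • b := by abel
    simp only [e1, e2, e3, e4]
    linarith [hSm b, hεm b]
  · have hlin : (fun y => ∑ ℓ ∈ t, (ℓ : E →L[ℝ] ℝ) (y - x) ^ 2)
        =o[𝓝[A] x] fun y => ‖y - x‖ ^ 2 :=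
      Asymptotics.IsLittleO.fun_sum fun ℓ _ => by
        have hℓ : (fun y => (ℓ : E →L[ℝ] ℝ) (y - x)) =o[𝓝[A] x] fun y => y - x := ℓ.2
        exact hℓ.norm_right.pow two_pos
    have htay : (fun y => ρ y - ρ x - d (y - x) - (1 / 2) * H (y - x) (y - x))
        =o[𝓝[A] x] fun y => ‖y - x‖ ^ 2 := by
      have hlim : Filter.Tendsto (fun y : E => y - x) (𝓝[A] x) (𝓝 0) := by
        have : Filter.Tendsto (fun y : E => y - x) (𝓝 x) (𝓝 (x - x)) :=
          (continuous_sub_right x).tendsto x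
        rw [sub_self] at this
        exact this.mono_left nhdsWithin_le_nhds
      have := (taylor_two_isLittleO hρ).comp_tendsto hlim
      simpa [Function.comp_def] using this
    have hκ : 0 < ε / (3 * N) := by positivity
    filter_upwards [Asymptotics.isLittleO_iff.mp hlin hκ, Asymptotics.isLittleO_iff.mp htay hκ,
      self_mem_nhdsWithin] with y h1 h2 hyA hyx
    have hn : 0 < ‖y - x‖ ^ 2 := by
      have := norm_pos_iff.mpr (sub_ne_zero.mpr hyx)
      positivity
    rw [hρA y hyA, hρx, Real.norm_eq_abs, norm_pow, norm_norm] at h2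
    rw [Real.norm_eq_abs, norm_pow, norm_norm] at h1
    have h1' := (le_abs_self _).trans h1
    have h2' := (neg_le_abs _).trans h2
    have h3 : 3 * (ε / (3 * N) * ‖y - x‖ ^ 2) ≤ ε * ‖T (y - x)‖ ^ 2 := by
      have := mul_le_mul_of_nonneg_left (hTN (y - x)) (by positivity : 0 ≤ ε / N)
      refine le_trans (le_of_eq ?_) (this.trans (le_of_eq ?_)) <;> field_simp
    have h4 : 0 < ε / (3 * N) * ‖y - x‖ ^ 2 := by positivity
    simp only [hq]
    linarith

end Barrier

/-! ### The Levi form on complexified tangent vectors -/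

section Algebra
variable {E : Type*} [NormedAddCommGroup E] [NormedSpace ℂ E]
  {X : Type*} [TopologicalSpace X] [ChartedSpace E X] {p : X}

/-- The vector `v - i J v ∈ T^{1,0}_p X` attached to a real tangent vector `v`. -/
noncomputable def holVector (p : X) (v : TangentSpace 𝓘(ℝ, E) p) : ComplexTangent E p :=
  (1 : ℂ) ⊗ₜ[ℝ] v - Complex.I ⊗ₜ[ℝ] complexStructure E p v

lemma complexStructure_complexStructure (v : TangentSpace 𝓘(ℝ, E) p) :
    complexStructure E p (complexStructure E p v) = -v := by
  have h (w : E) : Complex.I • Complex.I • w = -w := by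
    rw [smul_smul, Complex.I_mul_I, neg_one_smul]
  exact h v

lemma holVector_mem_holTangent (v : TangentSpace 𝓘(ℝ, E) p) :
    holVector p v ∈ holTangent E p := by
  rw [holTangent, Module.End.mem_eigenspace_iff, holVector, map_sub, LinearMap.baseChange_tmul,
    LinearMap.baseChange_tmul, complexStructure_complexStructure, smul_sub,
    TensorProduct.smul_tmul', TensorProduct.smul_tmul', smul_eq_mul, smul_eq_mul, mul_one,
    Complex.I_mul_I, TensorProduct.tmul_neg, TensorProduct.neg_tmul]
  abel

lemma holVector_mem_baseChange {S : Submodule ℝ (TangentSpace 𝓘(ℝ, E) p)}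
    {v : TangentSpace 𝓘(ℝ, E) p} (hv : v ∈ S) (hJv : complexStructure E p v ∈ S) :
    holVector p v ∈ S.baseChange ℂ :=
  sub_mem (Submodule.tmul_mem_baseChange_of_mem _ hv) (Submodule.tmul_mem_baseChange_of_mem _ hJv)

lemma holVector_ne_zero {v : TangentSpace 𝓘(ℝ, E) p} (hv : v ≠ 0) : holVector p v ≠ 0 := by
  intro h
  have h2 := congrArg (fun Z => TensorProduct.lid ℝ (TangentSpace 𝓘(ℝ, E) p)
    (LinearMap.rTensor (TangentSpace 𝓘(ℝ, E) p) Complex.reLm Z)) h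
  simp [holVector] at h2
  exact hv h2

lemma baseChange_conjC_conjC (H : LinearMap.BilinForm ℝ (TangentSpace 𝓘(ℝ, E) p))
    (Z W : ComplexTangent E p) :
    H.baseChange ℂ (conjC E p Z) (conjC E p W) = starRingEnd ℂ (H.baseChange ℂ Z W) := by
  induction Z using TensorProduct.induction_on with
  | zero => simp
  | add Z₁ Z₂ h₁ h₂ => simp only [map_add, LinearMap.add_apply, h₁, h₂]
  | tmul a v =>
    induction W using TensorProduct.induction_on with
    | zero => simp
    | add W₁ W₂ h₁ h₂ => simp only [map_add, h₁, h₂]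
    | tmul b w => simp [conjC]

lemma conjC_conjC (Z : ComplexTangent E p) : conjC E p (conjC E p Z) = Z := by
  induction Z using TensorProduct.induction_on with
  | zero => simp
  | add Z₁ Z₂ h₁ h₂ => simp only [map_add, h₁, h₂]
  | tmul a v => simp [conjC]

lemma conjC_smul (c : ℂ) (Z : ComplexTangent E p) :
    conjC E p (c • Z) = starRingEnd ℂ c • conjC E p Z := by
  induction Z using TensorProduct.induction_on with
  | zero => simp
  | add Z₁ Z₂ h₁ h₂ => simp only [smul_add, map_add, h₁, h₂]
  | tmul a v => simp [conjC, TensorProduct.smul_tmul']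

lemma leviForm_conj_symm {r : X → ℝ} (hr : (realHessian E r p).IsSymm) (Z W : ComplexTangent E p) :
    leviForm E r p W Z = starRingEnd ℂ (leviForm E r p Z W) := by
  rw [leviForm, leviForm, ← baseChange_conjC_conjC, conjC_conjC]
  exact (LinearMap.BilinForm.IsSymm.baseChange ℂ ⟨hr.eq⟩).eq _ _

lemma leviForm_holVector {r : X → ℝ} (hr : (realHessian E r p).IsSymm)
    (v : TangentSpace 𝓘(ℝ, E) p) :
    leviForm E r p (holVector p v) (holVector p v) =
      ((realHessian E r p v v
        + realHessian E r p (complexStructure E p v) (complexStructure E p v) : ℝ) : ℂ) := by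
  have hs := hr.eq v (complexStructure E p v)
  simp [leviForm, holVector, conjC, hs]
  ring

/-- The degenerate case of the Cauchy–Schwarz inequality: isotropic vectors of a positive
semidefinite Levi form are in its kernel. -/
lemma leviForm_eq_zero_of_self_eq_zero {r : X → ℝ} (hr : (realHessian E r p).IsSymm)
    {S : Submodule ℂ (ComplexTangent E p)} (hS : ∀ Z ∈ S, 0 ≤ (leviForm E r p Z Z).re)
    {Z W : ComplexTangent E p} (hZ : Z ∈ S) (hW : W ∈ S) (h0 : (leviForm E r p Z Z).re = 0) :
    leviForm E r p Z W = 0 := by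
  set b := leviForm E r p Z W with hb
  have hexp : ∀ c : ℂ, (leviForm E r p (W + c • Z) (W + c • Z)).re
      = (leviForm E r p W W).re + 2 * (c * b).re + Complex.normSq c * (leviForm E r p Z Z).re := by
    intro c
    have h1 : leviForm E r p (W + c • Z) (W + c • Z) = leviForm E r p W W
        + starRingEnd ℂ c * leviForm E r p W Z + c * leviForm E r p Z W
        + c * starRingEnd ℂ c * leviForm E r p Z Z := by
      simp only [leviForm, map_add, conjC_smul, map_smul, LinearMap.add_apply, LinearMap.smul_apply,
        smul_eq_mul]
      ring
    rw [h1, leviForm_conj_symm hr Z W, ← hb, Complex.mul_conj, ← map_mul]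
    simp only [Complex.add_re, Complex.conj_re, Complex.re_ofReal_mul]
    ring
  by_contra hne
  have hpos : 0 < Complex.normSq b := Complex.normSq_pos.mpr hne
  set w := (leviForm E r p W W).re with hw
  have hw0 : 0 ≤ w := hS W hW
  -- a negative multiple of `conj b` for which the expansion is `w - 2 (w + 1) < 0`
  have hneg := hS _ (add_mem hW (S.smul_mem
    ((-((w + 1) / Complex.normSq b) : ℝ) * starRingEnd ℂ b) hZ))
  rw [hexp, h0, mul_zero, add_zero, mul_assoc, mul_comm (starRingEnd ℂ b), Complex.mul_conj,
    ← Complex.ofReal_mul, Complex.ofReal_re, neg_mul, div_mul_cancel₀ _ hpos.ne'] at hneg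
  linarith

end Algebra

/-! ### Iterated derived distributions -/

section Iter
variable {E : Type*} [NormedAddCommGroup E] [NormedSpace ℂ E]
  {X : Type*} [TopologicalSpace X] [ChartedSpace E X] {M : Set X}

lemma tangentTo_mono {A B : Set X} (h : A ⊆ B) (p : X) : tangentTo E A p ≤ tangentTo E B p :=
  fun _ hv f hf hB => hv f hf fun a ha => hB a (h ha)

/-- If `D ∩ ℂ T K` vanishes nowhere on `K`, it survives in all derived distributions: as long as it
is contained in `D^(α)`, the support of `D^(α)` contains `K`, so that deriving `D^(α)` only
intersects it with a space containing `ℂ T K`. -/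
lemma ComplexDistribution.inf_tangentTo_le_iterDerived {D : ComplexDistribution E M} {K : Set X}
    (hKM : K ⊆ M)
    (hK : ∀ p (hp : p ∈ K), D ⟨p, hKM hp⟩ ⊓ (tangentTo E K p).baseChange ℂ ≠ ⊥)
    (α : Ordinal.{0}) : ∀ p (hp : p ∈ K), D ⟨p, hKM hp⟩ ⊓ (tangentTo E K p).baseChange ℂ
      ≤ D.iterDerived α ⟨p, hKM hp⟩ := by
  induction α using Ordinal.limitRecOn with
  | zero =>
    intro p hp
    rw [ComplexDistribution.iterDerived, Ordinal.limitRecOn_zero]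
    exact inf_le_left
  | add_one α ih =>
    intro p hp
    have hsupp : K ⊆ (D.iterDerived α).support := fun x hx =>
      ⟨hKM hx, fun h => hK x hx (eq_bot_iff.mpr (h ▸ ih x hx))⟩
    have heq : D.iterDerived (α + 1) = (D.iterDerived α).derived := by
      simp only [ComplexDistribution.iterDerived]
      exact Ordinal.limitRecOn_add_one ..
    rw [heq]
    exact le_inf (ih p hp) (inf_le_right.trans (Submodule.baseChange_mono _ (tangentTo_mono hsupp p)))
  | limit α hα ih =>
    intro p hp
    have heq : D.iterDerived α ⟨p, hKM hp⟩
        = ⨅ β : Set.Iio α, D.iterDerived β.1 ⟨p, hKM hp⟩ := by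
      simp only [ComplexDistribution.iterDerived]
      rw [Ordinal.limitRecOn_limit (h := hα)]
    rw [heq]
    exact le_iInf fun β => ih β.1 β.2 p hp

end Iter

/-! ### First-order behaviour of functions in the preferred chart -/

section Charts
variable {E : Type*} [NormedAddCommGroup E] [NormedSpace ℂ E]
  {X : Type*} [TopologicalSpace X] [ChartedSpace E X]

lemma contDiffAt_comp_chartAt_symm {f : X → ℝ} {p : X} {n : ℕ∞ω}
    (hf : ContMDiffAt 𝓘(ℝ, E) 𝓘(ℝ, ℝ) n f p) :
    ContDiffAt ℝ n (f ∘ (chartAt E p).symm) (chartAt E p p) := by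
  have := (contMDiffAt_iff.mp hf).2
  simpa [contDiffWithinAt_univ, Function.comp_def, chartAt_self_eq] using this

lemma mfderiv_eq_fderiv_comp_chartAt_symm {f : X → ℝ} {p : X}
    (hf : ContMDiffAt 𝓘(ℝ, E) 𝓘(ℝ, ℝ) 1 f p) (v : E) :
    mfderiv 𝓘(ℝ, E) 𝓘(ℝ, ℝ) f p v = fderiv ℝ (f ∘ (chartAt E p).symm) (chartAt E p p) v := by
  have hd : MDifferentiableAt 𝓘(ℝ, E) 𝓘(ℝ, ℝ) f p := hf.mdifferentiableAt (by norm_num)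
  simp [mfderiv, hd, writtenInExtChartAt, Function.comp_def]
  rfl

/-- The differential at `p ∈ K` of a function vanishing on `K` vanishes to first order along `K`. -/
lemma fderiv_isLittleO_of_eq_zero_on {f : X → ℝ} {p : X} {K : Set X}
    (hf : ContMDiffAt 𝓘(ℝ, E) 𝓘(ℝ, ℝ) 1 f p) (hp : p ∈ K) (hK : ∀ x ∈ K, f x = 0) :
    (fun y => fderiv ℝ (f ∘ (chartAt E p).symm) (chartAt E p p) (y - chartAt E p p))
      =o[𝓝[(chartAt E p).symm ⁻¹' K] (chartAt E p p)] fun y => y - chartAt E p p := by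
  have hd : DifferentiableAt ℝ (f ∘ (chartAt E p).symm) (chartAt E p p) :=
    (contDiffAt_comp_chartAt_symm hf).differentiableAt (by norm_num)
  have ho := (hasFDerivAt_iff_isLittleO.mp hd.hasFDerivAt).mono
    (nhdsWithin_le_nhds (s := (chartAt E p).symm ⁻¹' K))
  refine (ho.neg_left.congr' ?_ .rfl)
  filter_upwards [self_mem_nhdsWithin] with y hy
  have h1 : f ((chartAt E p).symm y) = 0 := hK _ hy
  have h2 : f ((chartAt E p).symm (chartAt E p p)) = 0 := by
    rw [(chartAt E p).left_inv (mem_chart_source E p)]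
    exact hK p hp
  rw [Function.comp_apply, Function.comp_apply, h1, h2]
  simp

end Charts

/-! ### Null vectors of a semidefinite Levi form -/

section Levi
variable {E : Type*} [NormedAddCommGroup E] [NormedSpace ℂ E]
  {X : Type*} [TopologicalSpace X] [ChartedSpace E X]

lemma holVector_mem_leviDistribution {Ω : Set X} {r : X → ℝ} (hpsc : IsLeviPseudoconvex E Ω r)
    {p : frontier Ω} (hr : (realHessian E r (p : X)).IsSymm) {v : TangentSpace 𝓘(ℝ, E) (p : X)}
    (hv : mfderiv 𝓘(ℝ, E) 𝓘(ℝ, ℝ) r p v = 0)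
    (hJv : mfderiv 𝓘(ℝ, E) 𝓘(ℝ, ℝ) r p (complexStructure E (p : X) v) = 0)
    (hle : realHessian E r (p : X) v v
      + realHessian E r p (complexStructure E (p : X) v) (complexStructure E (p : X) v) ≤ 0) :
    holVector (p : X) v ∈ leviDistribution E Ω r p := by
  have hcr : holVector (p : X) v ∈ crTangent E r (p : X) :=
    ⟨holVector_mem_baseChange hv hJv, holVector_mem_holTangent v⟩
  have h0 : (leviForm E r p (holVector (p : X) v) (holVector (p : X) v)).re = 0 := by
    refine le_antisymm ?_ (hpsc p p.2 _ hcr)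
    rw [leviForm_holVector hr, Complex.ofReal_re]
    exact hle
  exact ⟨hcr, fun W hW => leviForm_eq_zero_of_self_eq_zero hr (hpsc p p.2) hcr hW h0⟩

end Levi

/-! ### Local maximum sets in the boundary -/

section LocalMaximum
variable {E : Type*} [NormedAddCommGroup E] [NormedSpace ℂ E] [FiniteDimensional ℂ E]
  {X : Type*} [TopologicalSpace X] [T2Space X] [ChartedSpace E X] [IsManifold 𝓘(ℂ, E) ω X]

/-- A function in a chart with the four-point inequality (in particular plurisubharmonic) has no
strict local maximum over a local maximum set. The
preimage under `(chartAt E p).symm` describes `K` in the coordinates near `chartAt E p p`, where only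
points of the target of the chart matter. -/
lemma IsLocalMaximumSet.not_eventually_neg {K : Set X} (hK : IsLocalMaximumSet E K) {p : X}
    (hp : p ∈ K) {u : E → ℝ} (hc : Continuous u)
    (h4 : ∀ a b, 4 * u a ≤ u (a + b) + u (a - b) + u (a + Complex.I • b) + u (a - Complex.I • b))
    (h0 : u (chartAt E p p) = 0) :
    ¬ ∀ᶠ y in 𝓝[(chartAt E p).symm ⁻¹' K] (chartAt E p p), y ≠ chartAt E p p → u y < 0 := by
  intro hneg
  have : ProperSpace E := FiniteDimensional.proper ℂ E
  have : LocallyCompactSpace X := ChartedSpace.locallyCompactSpace E X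
  set e := chartAt E p with he
  have hpe : p ∈ e.source := mem_chart_source E p
  rw [eventually_nhdsWithin_iff] at hneg
  obtain ⟨N, ⟨hN, hNc⟩, hNsub⟩ := (closed_nhds_basis p).mem_iff.mp
    (Filter.inter_mem (e.open_source.mem_nhds hpe) ((e.continuousAt hpe).eventually hneg))
  obtain ⟨V, hVN, -, hpV, -, -, -, hmax⟩ := hK.2 p hp N hN
  have hVcl : closure V ⊆ N := closure_minimal hVN hNc
  have hsrc : closure V ⊆ e.source := fun y hy => (hNsub (hVcl hy)).1
  obtain ⟨q, ⟨⟨hqV, hqnV⟩, hqK⟩, hq⟩ := hmax e.source (fun x => (u (e x) : EReal)) e.open_source hsrc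
    (fun x hx => ⟨e, IsManifold.chart_mem_maximalAtlas p, hx, e.source, by simp, e.open_source, hx,
      isPSHOn_of_four_point hc h4 fun z hz => by
        rw [e.image_source_eq_target] at hz
        simp [e.right_inv hz]⟩)
  -- the maximum over the closure of `V` is at least `0`, but is attained at `q ≠ p`, where `u < 0`
  have hle := hq p ⟨subset_closure hpV, hp⟩
  rw [EReal.coe_le_coe_iff, h0] at hle
  have hqs := hsrc hqV
  have hne : e q ≠ e p := fun h => hqnV (e.injOn hqs hpe h ▸ hpV)
  have := (hNsub (hVcl hqV)).2 (by simpa [e.left_inv hqs] using hqK) hne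
  linarith

/-- The Levi null space at any point of a local maximum set contains a nonzero vector that is
tangent to the set. -/
lemma levi_inf_tangentTo_ne_bot {Ω U : Set X} {r : X → ℝ} (hopen : IsOpen Ω)
    (hr : IsDefiningFunction E Ω U r) (hpsc : IsLeviPseudoconvex E Ω r) {K : Set X}
    (hKM : K ⊆ frontier Ω) (hK : IsLocalMaximumSet E K) (p : X) (hp : p ∈ K) :
    leviDistribution E Ω r ⟨p, hKM hp⟩ ⊓ (tangentTo E K p).baseChange ℂ ≠ ⊥ := by
  intro hbot
  have hrU : ∀ x ∈ frontier Ω, ContMDiffAt 𝓘(ℝ, E) 𝓘(ℝ, ℝ) ∞ r x := fun x hx =>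
    hr.contMDiffOn.contMDiffAt (hr.isOpen.mem_nhds (hr.closure_subset (frontier_subset_closure hx)))
  have hr0 : ∀ x ∈ frontier Ω, r x = 0 := by
    intro x hx
    refine le_antisymm ?_ ?_
    · have hclos : x ∈ closure Ω := frontier_subset_closure hx
      refine (hrU x hx).continuousAt.continuousWithinAt.closure_le hclos continuousWithinAt_const ?_
      intro y hy
      rw [hr.eq_setOf] at hy
      exact hy.2.le
    · by_contra hlt
      rw [hopen.frontier_eq] at hx
      refine hx.2 ?_
      rw [hr.eq_setOf]
      exact ⟨hr.closure_subset hx.1, not_le.mp hlt⟩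
  have hpM := hKM hp
  have hrp := hrU p hpM
  set e := chartAt E p with he
  have hcd : ContDiffAt ℝ 2 (r ∘ e.symm) (e p) :=
    (contDiffAt_comp_chartAt_symm hrp).of_le (by norm_cast)
  have hsymm : (realHessian E r p).IsSymm :=
    ⟨fun v w => (hcd.isSymmSndFDerivAt (by simp)).eq v w⟩
  have hpe : e.symm (e p) = p := e.left_inv (mem_chart_source E p)
  obtain ⟨u, huc, hu4, hu0, hneg⟩ := exists_four_point_barrier (A := e.symm ⁻¹' K) hcd
    (by simpa [hpe] using hr0 p hpM) (fun y hy => hr0 _ (hKM hy)) (by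
      intro v hv
      by_contra! hcon
      obtain ⟨hle, hℓ⟩ := hcon
      have hvan : ∀ f : X → ℝ, ContMDiffAt 𝓘(ℝ, E) 𝓘(ℝ, ℝ) ∞ f p → (∀ x ∈ K, f x = 0) →
          mfderiv 𝓘(ℝ, E) 𝓘(ℝ, ℝ) f p v = 0 ∧
          mfderiv 𝓘(ℝ, E) 𝓘(ℝ, ℝ) f p (complexStructure E p v) = 0 := by
        intro f hf hfK
        have hf1 : ContMDiffAt 𝓘(ℝ, E) 𝓘(ℝ, ℝ) 1 f p := hf.of_le (by exact_mod_cast le_top)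
        have h0 := hℓ _ (fderiv_isLittleO_of_eq_zero_on hf1 hp hfK)
        exact ⟨(mfderiv_eq_fderiv_comp_chartAt_symm hf1 v).trans h0.1,
          (mfderiv_eq_fderiv_comp_chartAt_symm hf1 (Complex.I • v)).trans h0.2⟩
      have hdr := hvan r hrp fun x hx => hr0 x (hKM hx)
      have hN := holVector_mem_leviDistribution hpsc (p := ⟨p, hpM⟩) hsymm hdr.1 hdr.2 hle
      have hT : holVector (E := E) p v ∈ (tangentTo E K p).baseChange ℂ :=
        holVector_mem_baseChange (fun f hf hfK => (hvan f hf.contMDiffAt hfK).1)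
          (fun f hf hfK => (hvan f hf.contMDiffAt hfK).2)
      have hmem : holVector (E := E) p v ∈ leviDistribution E Ω r ⟨p, hpM⟩ ⊓
          (tangentTo E K p).baseChange ℂ := ⟨hN, hT⟩
      rw [hbot] at hmem
      exact holVector_ne_zero hv hmem)
  exact hK.not_eventually_neg hp huc hu4 hu0 hneg

end LocalMaximum
end LeviCore

theorem mainTheorem8
    {E : Type*} [NormedAddCommGroup E] [NormedSpace ℂ E] [FiniteDimensional ℂ E]
    {X : Type*} [TopologicalSpace X] [T2Space X] [ChartedSpace E X] [IsManifold 𝓘(ℂ, E) ω X]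
    (Ω : Set X) (hopen : IsOpen Ω) (hconn : IsConnected Ω)
    (U : Set X) (r : X → ℝ) (hr : LeviCore.IsDefiningFunction E Ω U r)
    (hpsc : LeviCore.IsLeviPseudoconvex E Ω r)
    (K : Set X) (hKM : K ⊆ frontier Ω) (hK : LeviCore.IsLocalMaximumSet E K) :
    K ⊆ (LeviCore.leviCore E Ω r).support := by
  have hne := LeviCore.levi_inf_tangentTo_ne_bot hopen hr hpsc hKM hK
  intro p hp
  refine ⟨hKM hp, fun h => hne p hp (eq_bot_iff.mpr ?_)⟩
  have hle := LeviCore.ComplexDistribution.inf_tangentTo_le_iterDerived hKM hne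
    (Ordinal.omega 1) p hp
  rwa [← h]
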